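/- Let $l^2(\mathbb N)$ be the space of square-summable complex sequences with canonical basis $\{e_n\}$, and let $P_n$ be the orthogonal projection onto $\mathrm{span}\{e_1,\dots,e_n\}$. Let $\Omega_{\mathrm{SA}}$ be the set of (possibly unbounded) self-adjoint operators $T$ on $l^2(\mathbb N)$ for which $\mathrm{span}\{e_n:n\in\mathbb N\}$ is a core. For $f:\mathbb N\to\mathbb N$ with $f(n)>n$ and sequences $\alpha=\{\alpha_n\}$, $\beta=\{\beta_n\}$ of non-negative real numbers converging to zero, let $\Omega_{f,\alpha,\beta}$ be the set of pairs $(T,x)\in\Omega_{\mathrm{SA}}\times l^2(\mathbb N)$ with $$\|(P_{f(n)}-I)TP_n\|=O(\alpha_n),\qquad \|P_nx-x\|=O(\beta_n)\qquad (n\to\infty),$$ where the implied constants may depend on $T$ and $x$. For $z\in\mathbb C\setminus\mathbb R$ write $R(z,T)=(T-zI)^{-1}$. There is a sequence of arithmetic algorithms $$\Gamma_n:\Omega_{f,\alpha,\beta}\times(\mathbb C\setminus\mathbb R)\to l^2(\mathbb N)$$ with properties (1) and (2) below. That the $\Gamma_n$ are arithmetic algorithms means: there is a single program for a real-number (Blum–Shub–Smale)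 machine with an oracle, the same for all $f,\alpha,\beta$, which on input $n$, with oracle access to the matrix entries $\langle Te_j,e_i\rangle$, the coefficients $\langle x,e_i\rangle$, the number $z$, and the values $f(k),\alpha_k,\beta_k$, halts after finitely many arithmetic operations, comparisons and oracle queries and outputs the finite string of coordinates of $\Gamma_n(T,x,z)$. 1. For all $(T,x)\in\Omega_{f,\alpha,\beta}$ and $z\in\mathbb C\setminus\mathbb R$, the operator $T-zI$ has a bounded inverse $R(z,T)$, each $\Gamma_n(T,x,z)$ has finite support with respect to the canonical basis, and $\Gamma_n(T,x,z)\to R(z,T)x$ in $l^2(\mathbb N)$ as $n\to\infty$. 2. For every $(T,x)\in\Omega_{f,\alpha,\beta}$ there is a constant $C(T,x)$ such that for all $z\in\mathbb C\setminus\mathbb R$ and all $n$ with $\alpha_n+\beta_n>0$, $$\|\Gamma_n(T,x,z)-R(z,T)x\|\le\frac{C(T,x)}{|\mathrm{Im}(z)|}\,[\alpha_n+\beta_n].$$ -/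

import Mathlib

open Filter Topology

namespace SCI

/-! ### Operators on the sequence space -/

/-- The Hilbert space of square-summable complex sequences, indexed by `0, 1, 2, …`. -/
abbrev Ell2 : Type := lp (fun _ : ℕ => ℂ) 2

/-- The canonical basis vectors; `e i` is the `(i+1)`-st one in one-based numbering. -/
noncomputable def e (i : ℕ) : Ell2 := lp.single 2 i (1 : ℂ)

/-- The finite linear combinations of the canonical basis vectors. -/
noncomputable def finSpan : Submodule ℂ Ell2 := Submodule.span ℂ (Set.range e)

/-- Closed densely defined operators such that the finite linear combinations of the canonical
basis vectors form a core of the operator and of its adjoint. -/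
structure IsCanonical (T : Ell2 →ₗ.[ℂ] Ell2) : Prop where
  closed : T.IsClosed
  dense : Dense (T.domain : Set Ell2)
  core : T.HasCore finSpan
  core_adjoint : T.adjoint.HasCore finSpan

/-- The class of self-adjoint operators of this kind (bounded or unbounded). -/
def OmegaSA : Set (Ell2 →ₗ.[ℂ] Ell2) :=
  {T | IsCanonical T ∧ IsSelfAdjoint T}

open scoped Classical in
/-- The value `T y`, extended by zero outside the domain of `T`. It is only used at canonical basis
vectors, which lie in the domain of every operator of the class considered. -/
noncomputable def app (T : Ell2 →ₗ.[ℂ] Ell2) (y : Ell2) : Ell2 :=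
  if h : y ∈ T.domain then T ⟨y, h⟩ else 0

/-- The orthogonal projection `P n` onto the span of the first `n` canonical basis vectors. -/
noncomputable def P (n : ℕ) : Ell2 →L[ℂ] Ell2 :=
  ∑ j ∈ Finset.range n, (innerSL ℂ (e j)).smulRight (e j)

/-- The bounded operator `T P_n`, sending `y` to `∑_{j < n} y_j T e_j`. -/
noncomputable def firstCols (T : Ell2 →ₗ.[ℂ] Ell2) (n : ℕ) : Ell2 →L[ℂ] Ell2 :=
  ∑ j ∈ Finset.range n, (innerSL ℂ (e j)).smulRight (app T (e j))

/-- The class of pairs `(T, x)` with `T` in `OmegaSA`, `‖(P_{f(n)} - I) T P_n‖ = O(α_n)` and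
`‖P_n x - x‖ = O(β_n)`; the implied constants may depend on `T` and on `x`. -/
def Omega (f : ℕ → ℕ) (α β : ℕ → ℝ) : Set ((Ell2 →ₗ.[ℂ] Ell2) × Ell2) :=
  {A | A.1 ∈ OmegaSA ∧
    (fun n => ‖(P (f n) - ContinuousLinearMap.id ℂ Ell2).comp (firstCols A.1 n)‖) =O[atTop] α ∧
    (fun n => ‖P n A.2 - A.2‖) =O[atTop] β}

/-- `R` is a bounded everywhere defined two-sided inverse of `T - z I`. -/
def IsResolventAt (T : Ell2 →ₗ.[ℂ] Ell2) (z : ℂ) (R : Ell2 →L[ℂ] Ell2) : Prop :=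
  (∀ y : Ell2, ∃ h : R y ∈ T.domain, T ⟨R y, h⟩ - z • R y = y) ∧
    ∀ u : T.domain, R (T u - z • (u : Ell2)) = u

/-- The complement of the spectrum of `T`. -/
def resolventPoints (T : Ell2 →ₗ.[ℂ] Ell2) : Set ℂ :=
  {z | ∃ R : Ell2 →L[ℂ] Ell2, IsResolventAt T z R}

open scoped Classical in
/-- The resolvent operator `R(z, T) = (T - z I)⁻¹`, for `z` outside the spectrum of `T`. -/
noncomputable def Res (z : ℂ) (T : Ell2 →ₗ.[ℂ] Ell2) : Ell2 →L[ℂ] Ell2 :=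
  if h : ∃ R : Ell2 →L[ℂ] Ell2, IsResolventAt T z R then h.choose else 0

/-! ### The machine model

A real-number machine with an oracle. Memory consists of integer registers and of real registers,
both indexed by `ℕ`; real registers may be addressed indirectly. In each step a machine performs
an arithmetic operation, a comparison, or a query to the oracle. The only built-in constants are
natural numbers, so a machine is a finite object, and on rational oracle values it is executed by an
oracle Turing machine; on real oracle values it is a Blum–Shub–Smale machine with an oracle. -/

/-- What the oracle can be asked: the function `f`, the terms of `α` and of `β`, the matrix
entries of the operator, the coefficients of the vector, and the spectral parameter. -/
structure OracleData where
  f : ℕ → ℕ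
  α : ℕ → ℝ
  β : ℕ → ℝ
  entry : ℕ → ℕ → ℂ
  coeff : ℕ → ℂ
  z : ℂ

/-- Memory contents. -/
structure Memory where
  nat : ℕ → ℕ
  real : ℕ → ℝ

/-- Integer-valued expressions; `reg i` is the content of the `i`-th integer register and `f a` is
a query for a value of `f`. -/
inductive NatExp : Type
  | const (c : ℕ)
  | reg (i : ℕ)
  | add (a b : NatExp)
  | sub (a b : NatExp)
  | mul (a b : NatExp)
  | div (a b : NatExp)
  | mod (a b : NatExp)
  | f (a : NatExp)

/-- Real-valued expressions; `reg a` is the content of the real register with address `a`. The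
last eight constructors are oracle queries; complex numbers are read through their real and
imaginary parts. -/
inductive RealExp : Type
  | ofNat (a : NatExp)
  | reg (a : NatExp)
  | add (p q : RealExp)
  | sub (p q : RealExp)
  | mul (p q : RealExp)
  | div (p q : RealExp)
  | alpha (a : NatExp)
  | beta (a : NatExp)
  | entryRe (a b : NatExp)
  | entryIm (a b : NatExp)
  | coeffRe (a : NatExp)
  | coeffIm (a : NatExp)
  | zRe
  | zIm

/-- Tests. -/
inductive Test : Type
  | natLt (a b : NatExp)
  | realLt (p q : RealExp)
  | not (b : Test)
  | and (b c : Test)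

/-- Programs. -/
inductive Program : Type
  | skip
  | setNat (i : ℕ) (a : NatExp)
  | setReal (a : NatExp) (p : RealExp)
  | seq (c d : Program)
  | ite (b : Test) (c d : Program)
  | while (b : Test) (c : Program)

/-- The value of an integer expression. Subtraction is truncated and division is integer division,
with `a / 0 = 0`. -/
def NatExp.eval (D : OracleData) (s : Memory) : NatExp → ℕ
  | .const c => c
  | .reg i => s.nat i
  | .add a b => a.eval D s + b.eval D s
  | .sub a b => a.eval D s - b.eval D s
  | .mul a b => a.eval D s * b.eval D s
  | .div a b => a.eval D s / b.eval D s
  | .mod a b => a.eval D s % b.eval D s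
  | .f a => D.f (a.eval D s)

/-- The value of a real expression. A division by zero returns zero. -/
noncomputable def RealExp.eval (D : OracleData) (s : Memory) : RealExp → ℝ
  | .ofNat a => (a.eval D s : ℝ)
  | .reg a => s.real (a.eval D s)
  | .add p q => p.eval D s + q.eval D s
  | .sub p q => p.eval D s - q.eval D s
  | .mul p q => p.eval D s * q.eval D s
  | .div p q => p.eval D s / q.eval D s
  | .alpha a => D.α (a.eval D s)
  | .beta a => D.β (a.eval D s)
  | .entryRe a b => (D.entry (a.eval D s) (b.eval D s)).re
  | .entryIm a b => (D.entry (a.eval D s) (b.eval D s)).im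
  | .coeffRe a => (D.coeff (a.eval D s)).re
  | .coeffIm a => (D.coeff (a.eval D s)).im
  | .zRe => D.z.re
  | .zIm => D.z.im

/-- The outcome of a test. -/
def Test.holds (D : OracleData) (s : Memory) : Test → Prop
  | .natLt a b => a.eval D s < b.eval D s
  | .realLt p q => p.eval D s < q.eval D s
  | .not b => ¬ b.holds D s
  | .and b c => b.holds D s ∧ c.holds D s

/-- `Exec D c s t`: with oracle `D`, the program `c` started with memory `s` halts after finitely
many steps with memory `t`. -/
inductive Exec (D : OracleData) : Program → Memory → Memory → Prop
  | skip (s : Memory) : Exec D .skip s s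
  | setNat (i : ℕ) (a : NatExp) (s : Memory) :
      Exec D (.setNat i a) s ⟨Function.update s.nat i (a.eval D s), s.real⟩
  | setReal (a : NatExp) (p : RealExp) (s : Memory) :
      Exec D (.setReal a p) s ⟨s.nat, Function.update s.real (a.eval D s) (p.eval D s)⟩
  | seq {c d : Program} {s t u : Memory} :
      Exec D c s t → Exec D d t u → Exec D (.seq c d) s u
  | ite_true {b : Test} {c d : Program} {s t : Memory} :
      b.holds D s → Exec D c s t → Exec D (.ite b c d) s t
  | ite_false {b : Test} {c d : Program} {s t : Memory} :
      ¬ b.holds D s → Exec D d s t → Exec D (.ite b c d) s t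
  | while_false {b : Test} {c : Program} {s : Memory} :
      ¬ b.holds D s → Exec D (.while b c) s s
  | while_true {b : Test} {c : Program} {s t u : Memory} :
      b.holds D s → Exec D c s t → Exec D (.while b c) t u → Exec D (.while b c) s u

/-- The initial memory on input `n`: the input is in integer register `0`, all else is zero. -/
def initMem (n : ℕ) : Memory where
  nat := Function.update (fun _ => 0) 0 n
  real := fun _ => 0

/-- The vector that a final memory represents: integer register `0` holds the length of the output
string, and real registers `2 i` and `2 i + 1` hold the real and imaginary parts of its entry with
index `i`, which is the `i`-th coordinate of the vector. -/
noncomputable def output (t : Memory) : Ell2 :=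
  ∑ i ∈ Finset.range (t.nat 0),
    ((t.real (2 * i) : ℂ) + (t.real (2 * i + 1) : ℂ) * Complex.I) • e i

/-- The program `M` with oracle `D` halts on input `n` and outputs the vector `v`. -/
def Computes (M : Program) (D : OracleData) (n : ℕ) (v : Ell2) : Prop :=
  ∃ t : Memory, Exec D M (initMem n) t ∧ output t = v

/-- The oracle belonging to an input: the matrix entries `⟨T e_j, e_i⟩` (in the convention with
the inner product linear in its first argument), the coefficients `⟨x, e_i⟩`, and `f`, `α`, `β`
and `z`. -/
noncomputable def oracle (f : ℕ → ℕ) (α β : ℕ → ℝ) (T : Ell2 →ₗ.[ℂ] Ell2) (x : Ell2) (z : ℂ) :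
    OracleData where
  f := f
  α := α
  β := β
  entry i j := inner ℂ (e i) (app T (e j))
  coeff i := inner ℂ (e i) x
  z := z

end SCI

/-!
The theorem is proved by exhaustive search. For a self-adjoint `T` and `z` off the real axis one has
`|Im z| ‖u‖ ≤ ‖(T - z) u‖` on the domain (`abs_im_mul_norm_le`), which makes `T - z` boundedly
invertible (`mem_resolventPoints`) and bounds the error of an approximate solution `u` of
`(T - z) u = x` by its residual divided by `|Im z|` (`norm_sub_Res_le`). It is therefore enough to
find a finitely supported vector `y` whose residual is certifiably of the size of the tolerance `ε`,
which is `α_n + β_n`, or `1 / (n + 1)` where that sum vanishes.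

The machine runs through pairs of a size `k` and a finite rational vector `y` supported in the
first `k` coordinates, and outputs the first `y` such that
* `‖P_{f(k)} ((T - z) y - x)‖ < ε`,
* `(α_k + 1 / (k + 1)) ‖y‖ < ε`,
* `β_k + 1 / (k + 1) < ε`,

with squared norms in the first two tests, so that no square roots are needed. The part of the
residual outside the section consists of `(P_{f(k)} - I) T P_k y` and of a tail of `x`; the last two
tests bound it by a constant times `ε`, the constant coming from the two `O`-hypotheses and hence
independent of `z` (`exists_norm_residual_le_of_accepts`). The summand `1 / (k + 1)` matters: the
hypotheses say nothing about small `k`, where `α_k` and `β_k` may be zero, and `‖y‖` is not bounded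
uniformly in `z`.

The search halts because the finite linear combinations form a core: some finitely supported, and
then some rational, `y` has residual below `ε`, and for a fixed `y` the remaining tests hold for all
large `k` (`exists_accepts`). Vectors are coded by numbers through Gödel's beta function, so that
decoding a coordinate is a single arithmetic expression. Correctness of the program is a
total-correctness argument with a rule for loops (`Ensures.whileLoop`); its outcome is
`computes_searchProgram`.
-/

namespace SCI

/-! ### Total correctness of programs -/

/-- With oracle `D` and initial memory `s`, the program `c` halts with a memory satisfying `Q`. -/
def Ensures (D : OracleData) (c : Program) (s : Memory) (Q : Memory → Prop) : Prop :=
  ∃ t, Exec D c s t ∧ Q t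

namespace Ensures

variable {D : OracleData} {s : Memory} {Q R : Memory → Prop}

theorem mono {c : Program} (h : Ensures D c s Q) (hQR : ∀ t, Q t → R t) : Ensures D c s R :=
  let ⟨t, ht, hQ⟩ := h
  ⟨t, ht, hQR t hQ⟩

theorem skip (h : Q s) : Ensures D .skip s Q := ⟨s, .skip s, h⟩

theorem setNat {i : ℕ} {a : NatExp} (h : Q ⟨Function.update s.nat i (a.eval D s), s.real⟩) :
    Ensures D (.setNat i a) s Q := ⟨_, .setNat i a s, h⟩

theorem setReal {a : NatExp} {p : RealExp}
    (h : Q ⟨s.nat, Function.update s.real (a.eval D s) (p.eval D s)⟩) :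
    Ensures D (.setReal a p) s Q := ⟨_, .setReal a p s, h⟩

theorem seq {c d : Program} (h : Ensures D c s fun t => Ensures D d t Q) :
    Ensures D (.seq c d) s Q :=
  let ⟨_, ht, u, hu, hQ⟩ := h
  ⟨u, .seq ht hu, hQ⟩

theorem ite {b : Test} {c d : Program} (hc : b.holds D s → Ensures D c s Q)
    (hd : ¬ b.holds D s → Ensures D d s Q) : Ensures D (.ite b c d) s Q := by
  by_cases hb : b.holds D s
  · obtain ⟨t, ht, hQ⟩ := hc hb
    exact ⟨t, .ite_true hb ht, hQ⟩
  · obtain ⟨t, ht, hQ⟩ := hd hb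
    exact ⟨t, .ite_false hb ht, hQ⟩

/-- Rule for loops: `I m` is an invariant at the `m`-th visit of the test, which fails exactly when
the stopping condition `G m` holds. -/
theorem whileLoop {b : Test} {c : Program} (I : ℕ → Memory → Prop) (G : ℕ → Prop)
    (hG : ∃ m, G m) (htest : ∀ m s, I m s → (b.holds D s ↔ ¬ G m))
    (hbody : ∀ m s, ¬ G m → I m s → Ensures D c s (I (m + 1))) (hs : I 0 s) :
    Ensures D (.while b c) s fun t => ∃ m, G m ∧ I m t := by
  obtain ⟨N, hN⟩ := hG
  have key : ∀ r m s, m + r = N → I m s →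
      Ensures D (.while b c) s fun t => ∃ m, G m ∧ I m t := by
    intro r
    induction r with
    | zero =>
      intro m s hm hI
      obtain rfl : m = N := by omega
      exact ⟨s, .while_false fun h => (htest m s hI).1 h hN, m, hN, hI⟩
    | succ r ih =>
      intro m s hm hI
      by_cases hGm : G m
      · exact ⟨s, .while_false fun h => (htest m s hI).1 h hGm, m, hGm, hI⟩
      · obtain ⟨t, ht, hIt⟩ := hbody m s hGm hI
        obtain ⟨u, hu, hQ⟩ := ih (m + 1) t (by omega) hIt
        exact ⟨u, .while_true ((htest m s hI).2 hGm) ht hu, hQ⟩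
  exact key N 0 s (by omega) hs

end Ensures

/-- The program `r := 0; for i < b do (c; r := r + p)`, for an integer register `i` and a real
register `r`. -/
def sumLoop (i : ℕ) (b : NatExp) (c : Program) (r : ℕ) (p : RealExp) : Program :=
  .seq (.setReal (.const r) (.ofNat (.const 0))) <|
  .seq (.setNat i (.const 0)) <|
  .while (.natLt (.reg i) b) <|
    .seq c <|
    .seq (.setReal (.const r) (.add (.reg (.const r)) p)) (.setNat i (.add (.reg i) (.const 1)))

/-- `I` collects the facts about the memory that the loop preserves; it must not constrain the two
registers that the loop uses. -/
theorem Ensures.sumLoop {D : OracleData} {i r B : ℕ} {b : NatExp} {c : Program} {p : RealExp}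
    {s : Memory} (I : Memory → Prop) (F : ℕ → ℝ)
    (hIi : ∀ s v, I s → I ⟨Function.update s.nat i v, s.real⟩)
    (hIr : ∀ s v, I s → I ⟨s.nat, Function.update s.real r v⟩)
    (hb : ∀ s, I s → b.eval D s = B)
    (hbody : ∀ s, I s → s.nat i < B → Ensures D c s fun t =>
      I t ∧ t.nat i = s.nat i ∧ t.real r = s.real r ∧ p.eval D t = F (s.nat i))
    (hs : I s) :
    Ensures D (sumLoop i b c r p) s fun t => I t ∧ t.real r = ∑ m ∈ Finset.range B, F m := by
  refine .seq <| .setReal <| .seq <| .setNat <| (Ensures.whileLoop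
    (fun m t => I t ∧ t.nat i = m ∧ m ≤ B ∧ t.real r = ∑ l ∈ Finset.range m, F l)
    (fun m => B ≤ m) ⟨B, le_rfl⟩ ?_ ?_ ?_).mono ?_
  · rintro m t ⟨hI, hi, -, -⟩
    simp [Test.holds, NatExp.eval, hb t hI, hi]
  · rintro m t hm ⟨hI, hi, -, hr⟩
    refine .seq <| (hbody t hI (by omega)).mono ?_
    rintro u ⟨hIu, hui, hur, hp⟩
    refine .seq <| .setReal <| .setNat ⟨hIi _ _ (hIr _ _ hIu), ?_, by omega, ?_⟩
    · simp [NatExp.eval, hui, hi]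
    · simp [NatExp.eval, RealExp.eval, hur, hp, hr, hi, Finset.sum_range_succ]
  · exact ⟨hIi _ _ (hIr _ _ hs), by simp [NatExp.eval], by simp,
      by simp [NatExp.eval, RealExp.eval]⟩
  · rintro t ⟨m, hm, hI, -, hmB, hr⟩
    obtain rfl : m = B := le_antisymm hmB hm
    exact ⟨hI, hr⟩

/-! ### Codes of finite rational vectors -/

/-- The `i`-th term of the finite sequence of natural numbers coded by `c` and `d` through Gödel's
beta function. -/
def betaTerm (c d i : ℕ) : ℕ := c % ((i + 1) * d + 1)

/-- The real part of the `j`-th coordinate of the vector with code `(c, d, q)`: a difference of two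
terms of the coded sequence over the common denominator `q + 1`. -/
noncomputable def coordRe (c d q j : ℕ) : ℝ :=
  ((betaTerm c d (4 * j) : ℝ) - betaTerm c d (4 * j + 1)) / ((q + 1 : ℕ) : ℝ)

/-- The imaginary part of the `j`-th coordinate of the vector with code `(c, d, q)`. -/
noncomputable def coordIm (c d q j : ℕ) : ℝ :=
  ((betaTerm c d (4 * j + 2) : ℝ) - betaTerm c d (4 * j + 3)) / ((q + 1 : ℕ) : ℝ)

/-- The `j`-th coordinate of the vector that belongs to `w < k ^ 4`: the base-`k` digits of `w` are
the parameters `c`, `d`, `q` of a code and the dimension. -/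
noncomputable def coord (k w j : ℕ) : ℂ :=
  ⟨coordRe (w % k) (w / k % k) (w / k / k % k) j, coordIm (w % k) (w / k % k) (w / k / k % k) j⟩

/-- The number of coordinates of the vector that belongs to `w < k ^ 4`. -/
def dim (k w : ℕ) : ℕ := w / k / k / k

/-- The finitely supported vector that belongs to `w < k ^ 4`. -/
noncomputable def codeVec (k w : ℕ) : Ell2 := ∑ j ∈ Finset.range (dim k w), coord k w j • e j

/-- The successor in the enumeration of all pairs `(k, w)` with `w < k ^ 4`, preceded by
`(0, 0)`, which stands for the zero vector. -/
def nextPair (q : ℕ × ℕ) : ℕ × ℕ := if q.2 + 1 < q.1 ^ 4 then (q.1, q.2 + 1) else (q.1 + 1, 0)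

theorem exists_iterate_nextPair {k w : ℕ} (hw : w < k ^ 4) : ∃ m, nextPair^[m] (0, 0) = (k, w) := by
  have row : ∀ k, (∃ m, nextPair^[m] (0, 0) = (k, 0)) → ∀ w, w < k ^ 4 →
      ∃ m, nextPair^[m] (0, 0) = (k, w) := by
    intro k h0 w
    induction w with
    | zero => exact fun _ => h0
    | succ w ih =>
      intro hw
      obtain ⟨m, hm⟩ := ih (by omega)
      exact ⟨m + 1, by rw [Function.iterate_succ_apply', hm]; simp [nextPair, hw]⟩
  have start : ∀ k, ∃ m, nextPair^[m] (0, 0) = (k, 0) := by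
    intro k
    induction k with
    | zero => exact ⟨0, rfl⟩
    | succ k ih =>
      rcases Nat.eq_zero_or_pos k with rfl | hk
      · exact ⟨1, rfl⟩
      · have hk4 : 0 < k ^ 4 := by positivity
        obtain ⟨m, hm⟩ := row k ih (k ^ 4 - 1) (by omega)
        refine ⟨m + 1, ?_⟩
        rw [Function.iterate_succ_apply', hm, nextPair, if_neg (by simp only; omega)]
  exact row k (start k) w hw

/-! ### The program -/

/-- Integer register `1`, the size parameter `k` of the current trial. -/
def kExp : NatExp := .reg 1

/-- Integer register `2`, the number `w` of the current trial. -/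
def wExp : NatExp := .reg 2

/-- Evaluates to `dim k w`. -/
def dimExp : NatExp := .div (.div (.div wExp kExp) kExp) kExp

/-- Evaluates to the `a`-th term of the sequence coded by the digits of `w`. -/
def betaExp (a : NatExp) : NatExp :=
  .mod (.mod wExp kExp)
    (.add (.mul (.add a (.const 1)) (.mod (.div wExp kExp) kExp)) (.const 1))

/-- Evaluates to the common denominator of the coordinates of the trial vector. -/
def denExp : RealExp := .ofNat (.add (.mod (.div (.div wExp kExp) kExp) kExp) (.const 1))

/-- Evaluates to the real part of the `j`-th coordinate of the trial vector. -/
def coordReExp (j : NatExp) : RealExp :=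
  .div (.sub (.ofNat (betaExp (.mul (.const 4) j)))
    (.ofNat (betaExp (.add (.mul (.const 4) j) (.const 1))))) denExp

/-- Evaluates to the imaginary part of the `j`-th coordinate of the trial vector. -/
def coordImExp (j : NatExp) : RealExp :=
  .div (.sub (.ofNat (betaExp (.add (.mul (.const 4) j) (.const 2))))
    (.ofNat (betaExp (.add (.mul (.const 4) j) (.const 3))))) denExp

/-- The Kronecker delta, through truncated subtraction. -/
def deltaExp (i j : NatExp) : RealExp :=
  .ofNat (.sub (.const 1) (.add (.sub i j) (.sub j i)))

/-- Evaluates to the real part of the matrix entry of `T - z` at `(i, j)`. -/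
def shiftReExp (i j : NatExp) : RealExp := .sub (.entryRe i j) (.mul (deltaExp i j) .zRe)

/-- Evaluates to the imaginary part of the matrix entry of `T - z` at `(i, j)`. -/
def shiftImExp (i j : NatExp) : RealExp := .sub (.entryIm i j) (.mul (deltaExp i j) .zIm)

def sqExp (p : RealExp) : RealExp := .mul p p

/-- Adds up in real registers `0` and `1` the real and imaginary parts of the row with index
`.reg 3` of the shifted matrix times the vector. -/
def rowProgram : Program :=
  .seq
    (sumLoop 4 dimExp .skip 0
      (.sub (.mul (shiftReExp (.reg 3) (.reg 4)) (coordReExp (.reg 4)))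
        (.mul (shiftImExp (.reg 3) (.reg 4)) (coordImExp (.reg 4)))))
    (sumLoop 4 dimExp .skip 1
      (.add (.mul (shiftReExp (.reg 3) (.reg 4)) (coordImExp (.reg 4)))
        (.mul (shiftImExp (.reg 3) (.reg 4)) (coordReExp (.reg 4)))))

/-- Computes the square of the norm of the finite section of the residual in real register `2`, and
the square of the norm of the trial vector in real register `3`. -/
def trialProgram : Program :=
  .seq
    (sumLoop 3 (.f kExp) rowProgram 2
      (.add (sqExp (.sub (.reg (.const 0)) (.coeffRe (.reg 3))))
        (sqExp (.sub (.reg (.const 1)) (.coeffIm (.reg 3))))))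
    (sumLoop 3 dimExp .skip 3
      (.add (sqExp (coordReExp (.reg 3))) (sqExp (coordImExp (.reg 3)))))

def invSuccExp (a : NatExp) : RealExp := .div (.ofNat (.const 1)) (.ofNat (.add a (.const 1)))

/-- The acceptance test; real register `4` holds the tolerance. -/
def acceptTest : Test :=
  .and (.natLt dimExp (.add kExp (.const 1))) <|
  .and (.realLt (.reg (.const 2)) (sqExp (.reg (.const 4)))) <|
  .and (.realLt (.mul (sqExp (.add (.alpha kExp) (invSuccExp kExp))) (.reg (.const 3)))
    (sqExp (.reg (.const 4)))) <|
  .realLt (.add (.beta kExp) (invSuccExp kExp)) (.reg (.const 4))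

/-- Replaces the pair in registers `1` and `2` by its successor under `nextPair`. -/
def nextProgram : Program :=
  .ite (.natLt (.add wExp (.const 1)) (.mul (.mul (.mul kExp kExp) kExp) kExp))
    (.setNat 2 (.add wExp (.const 1)))
    (.seq (.setNat 1 (.add kExp (.const 1))) (.setNat 2 (.const 0)))

/-- Stores the tolerance `tol` in real register `4`; the input is still in integer register `0`. -/
def toleranceProgram : Program :=
  .ite (.realLt (.ofNat (.const 0)) (.add (.alpha (.reg 0)) (.beta (.reg 0))))
    (.setReal (.const 4) (.add (.alpha (.reg 0)) (.beta (.reg 0))))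
    (.setReal (.const 4) (invSuccExp (.reg 0)))

/-- Writes the coordinates of the trial vector into the output registers. -/
def outputProgram : Program :=
  .seq (.setNat 3 (.const 0)) <|
  .seq
    (.while (.natLt (.reg 3) dimExp) <|
      .seq (.setReal (.mul (.const 2) (.reg 3)) (coordReExp (.reg 3))) <|
      .seq (.setReal (.add (.mul (.const 2) (.reg 3)) (.const 1)) (coordImExp (.reg 3)))
        (.setNat 3 (.add (.reg 3) (.const 1))))
    (.setNat 0 dimExp)

/-- Enumerates the finite rational vectors and outputs the first one that passes the test. -/
def searchProgram : Program :=
  .seq toleranceProgram <|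
  .seq trialProgram <|
  .seq (.while (.not acceptTest) (.seq nextProgram trialProgram)) outputProgram

/-! ### Semantics of the program -/

/-- The tolerance of the machine at input `n`. -/
noncomputable def tol (α β : ℕ → ℝ) (n : ℕ) : ℝ :=
  if 0 < α n + β n then α n + β n else 1 / ((n + 1 : ℕ) : ℝ)

/-- The entry of the matrix shifted by `z`. -/
noncomputable def shiftEntry (D : OracleData) (i j : ℕ) : ℂ :=
  D.entry i j - (if i = j then 1 else 0) * D.z

/-- The square of the norm of the finite section of the residual of the trial vector. -/
noncomputable def sqResidual (D : OracleData) (k w : ℕ) : ℝ :=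
  ∑ i ∈ Finset.range (D.f k),
    ‖∑ j ∈ Finset.range (dim k w), shiftEntry D i j * coord k w j - D.coeff i‖ ^ 2

/-- The trial vector that belongs to `w < k ^ 4` is accepted with tolerance `ε`. -/
def Accepts (D : OracleData) (ε : ℝ) (k w : ℕ) : Prop :=
  dim k w ≤ k ∧
  sqResidual D k w < ε ^ 2 ∧
  (D.α k + 1 / ((k + 1 : ℕ) : ℝ)) ^ 2 * ∑ j ∈ Finset.range (dim k w), ‖coord k w j‖ ^ 2 < ε ^ 2 ∧
  D.β k + 1 / ((k + 1 : ℕ) : ℝ) < ε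

section Semantics

variable {D : OracleData} {s : Memory} {n k w : ℕ} {ε : ℝ}

/-- The memory during the trial of `(k, w)` on tolerance `ε`. -/
def TrialState (k w : ℕ) (ε : ℝ) (s : Memory) : Prop :=
  s.nat 1 = k ∧ s.nat 2 = w ∧ s.real 4 = ε

theorem eval_dimExp (h1 : s.nat 1 = k) (h2 : s.nat 2 = w) : dimExp.eval D s = dim k w := by
  subst h1 h2; rfl

theorem eval_coordReExp (h1 : s.nat 1 = k) (h2 : s.nat 2 = w) (j : NatExp) :
    (coordReExp j).eval D s = (coord k w (j.eval D s)).re := by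
  subst h1 h2; rfl

theorem eval_coordImExp (h1 : s.nat 1 = k) (h2 : s.nat 2 = w) (j : NatExp) :
    (coordImExp j).eval D s = (coord k w (j.eval D s)).im := by
  subst h1 h2; rfl

theorem eval_deltaExp (i j : NatExp) :
    (deltaExp i j).eval D s = if i.eval D s = j.eval D s then 1 else 0 := by
  simp only [deltaExp, RealExp.eval, NatExp.eval]
  split_ifs with h
  · simp [h]
  · rw [show 1 - (i.eval D s - j.eval D s + (j.eval D s - i.eval D s)) = 0 by omega, Nat.cast_zero]

theorem eval_shiftReExp (i j : NatExp) :
    (shiftReExp i j).eval D s = (shiftEntry D (i.eval D s) (j.eval D s)).re := by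
  simp only [shiftReExp, RealExp.eval, eval_deltaExp, shiftEntry]
  split_ifs <;> simp

theorem eval_shiftImExp (i j : NatExp) :
    (shiftImExp i j).eval D s = (shiftEntry D (i.eval D s) (j.eval D s)).im := by
  simp only [shiftImExp, RealExp.eval, eval_deltaExp, shiftEntry]
  split_ifs <;> simp

theorem ensures_rowProgram {i : ℕ} {v : ℝ} (hs : TrialState k w ε s) (h3 : s.nat 3 = i)
    (hv : s.real 2 = v) :
    Ensures D rowProgram s fun t => TrialState k w ε t ∧ t.nat 3 = i ∧ t.real 2 = v ∧
      t.real 0 = (∑ j ∈ Finset.range (dim k w), shiftEntry D i j * coord k w j).re ∧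
      t.real 1 = (∑ j ∈ Finset.range (dim k w), shiftEntry D i j * coord k w j).im := by
  refine .seq <| (Ensures.sumLoop
    (fun t => TrialState k w ε t ∧ t.nat 3 = i ∧ t.real 2 = v)
    (fun j => (shiftEntry D i j * coord k w j).re) ?_ ?_
    (fun t ht => eval_dimExp ht.1.1 ht.1.2.1) ?_ ⟨hs, h3, hv⟩).mono ?_
  · intro t m; simp [TrialState]
  · intro t x; simp [TrialState]
  · rintro t ⟨ht, h3, hv⟩ -
    refine .skip ⟨⟨ht, h3, hv⟩, rfl, rfl, ?_⟩
    simp [RealExp.eval, eval_coordReExp ht.1 ht.2.1, eval_coordImExp ht.1 ht.2.1,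
      eval_shiftReExp, eval_shiftImExp, NatExp.eval, h3]
  rintro t ⟨⟨ht, h3, hv⟩, h0⟩
  refine (Ensures.sumLoop
    (fun t => TrialState k w ε t ∧ t.nat 3 = i ∧ t.real 2 = v ∧
      t.real 0 = (∑ j ∈ Finset.range (dim k w), shiftEntry D i j * coord k w j).re)
    (fun j => (shiftEntry D i j * coord k w j).im) ?_ ?_
    (fun t ht => eval_dimExp ht.1.1 ht.1.2.1) ?_ ⟨ht, h3, hv, ?_⟩).mono ?_
  · intro t m; simp [TrialState]
  · intro t x; simp [TrialState]
  · rintro t ⟨ht, h3, hv⟩ -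
    refine .skip ⟨⟨ht, h3, hv⟩, rfl, rfl, ?_⟩
    simp [RealExp.eval, eval_coordReExp ht.1 ht.2.1, eval_coordImExp ht.1 ht.2.1,
      eval_shiftReExp, eval_shiftImExp, NatExp.eval, h3]
  · rw [h0, Complex.re_sum]
  · rintro u ⟨⟨hu, h3, hv, h0⟩, h1⟩
    exact ⟨hu, h3, hv, h0, by rw [h1, Complex.im_sum]⟩

theorem ensures_trialProgram (hs : TrialState k w ε s) :
    Ensures D trialProgram s fun t => TrialState k w ε t ∧ t.real 2 = sqResidual D k w ∧
      t.real 3 = ∑ j ∈ Finset.range (dim k w), ‖coord k w j‖ ^ 2 := by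
  refine .seq <| (Ensures.sumLoop (TrialState k w ε)
    (fun i => ‖∑ j ∈ Finset.range (dim k w), shiftEntry D i j * coord k w j - D.coeff i‖ ^ 2)
    ?_ ?_ (B := D.f k) ?_ ?_ hs).mono ?_
  · intro t m; simp [TrialState]
  · intro t x; simp [TrialState]
  · rintro t ⟨rfl, -, -⟩; rfl
  · intro t ht _
    refine (ensures_rowProgram ht rfl rfl).mono ?_
    rintro u ⟨hu, h3, h2, h0, h1⟩
    refine ⟨hu, h3, h2, ?_⟩
    rw [← Complex.normSq_eq_norm_sq, Complex.normSq_apply, Complex.sub_re, Complex.sub_im]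
    simp [sqExp, RealExp.eval, NatExp.eval, h0, h1, h3]
  rintro t ⟨ht, h2⟩
  refine (Ensures.sumLoop (fun t => TrialState k w ε t ∧ t.real 2 = sqResidual D k w)
    (fun j => ‖coord k w j‖ ^ 2) ?_ ?_ (fun t ht => eval_dimExp ht.1.1 ht.1.2.1) ?_
    ⟨ht, h2⟩).mono fun u hu => ⟨hu.1.1, hu.1.2, hu.2⟩
  · intro t m; simp [TrialState]
  · intro t x; simp [TrialState]
  · rintro t ⟨ht, h2⟩ -
    refine .skip ⟨⟨ht, h2⟩, rfl, rfl, ?_⟩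
    rw [← Complex.normSq_eq_norm_sq, Complex.normSq_apply]
    simp [sqExp, RealExp.eval, eval_coordReExp ht.1 ht.2.1, eval_coordImExp ht.1 ht.2.1,
      NatExp.eval]

theorem holds_acceptTest (hs : TrialState k w ε s) (h2 : s.real 2 = sqResidual D k w)
    (h3 : s.real 3 = ∑ j ∈ Finset.range (dim k w), ‖coord k w j‖ ^ 2) :
    acceptTest.holds D s ↔ Accepts D ε k w := by
  obtain ⟨rfl, rfl, rfl⟩ := hs
  simp [acceptTest, Accepts, Test.holds, RealExp.eval, NatExp.eval, sqExp, invSuccExp, h2,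
    eval_dimExp rfl rfl, h3, sq, kExp, Order.lt_add_one_iff]

theorem ensures_nextProgram (hs : TrialState k w ε s) :
    Ensures D nextProgram s
      (TrialState (nextPair (k, w)).1 (nextPair (k, w)).2 ε) := by
  obtain ⟨rfl, rfl, rfl⟩ := hs
  have hpow : s.nat 1 * s.nat 1 * s.nat 1 * s.nat 1 = s.nat 1 ^ 4 := by ring
  refine .ite (fun h => .setNat ?_) (fun h => .seq <| .setNat <| .setNat ?_)
  all_goals
    simp only [Test.holds, NatExp.eval, wExp, kExp, hpow] at h
    simp [TrialState, nextPair, h, NatExp.eval, wExp, kExp]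

theorem ensures_outputProgram (hs : TrialState k w ε s) :
    Ensures D outputProgram s fun t => output t = codeVec k w := by
  refine .seq <| .setNat <| .seq <| (Ensures.whileLoop
    (fun m t => t.nat 1 = k ∧ t.nat 2 = w ∧ t.nat 3 = m ∧ m ≤ dim k w ∧
      ∀ j < m, t.real (2 * j) = (coord k w j).re ∧ t.real (2 * j + 1) = (coord k w j).im)
    (fun m => dim k w ≤ m) ⟨_, le_rfl⟩ ?_ ?_ ?_).mono ?_
  · rintro m t ⟨h1, h2, h3, -, -⟩
    simp [Test.holds, eval_dimExp h1 h2, NatExp.eval, h3]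
  · rintro m t hm ⟨h1, h2, h3, -, hj⟩
    refine .seq <| .setReal <| .seq <| .setReal <| .setNat
      ⟨by simp [h1], by simp [h2], by simp [NatExp.eval, h3], by omega, fun j hjm => ?_⟩
    have hre := eval_coordReExp (D := D) h1 h2 (.reg 3)
    have him := eval_coordImExp (D := D)
      (s := ⟨t.nat, Function.update t.real (2 * m) (coord k w m).re⟩) h1 h2 (.reg 3)
    simp only [NatExp.eval, h3] at hre him ⊢
    rw [hre, him]
    rcases Nat.lt_succ_iff_lt_or_eq.1 hjm with h | rfl
    · simpa [Function.update_apply, show 2 * j ≠ 2 * m + 1 by omega, show j ≠ m by omega,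
        show 2 * j + 1 ≠ 2 * m by omega] using hj j h
    · simp
  · exact ⟨by simpa using hs.1, by simpa using hs.2.1, by simp [NatExp.eval], by simp, by simp⟩
  · rintro t ⟨m, hm, h1, h2, -, hmd, hj⟩
    obtain rfl : m = dim k w := le_antisymm hmd hm
    refine .setNat ?_
    simp only [output, codeVec, Function.update_self, eval_dimExp h1 h2]
    refine Finset.sum_congr rfl fun j hjm => ?_
    rw [(hj j (Finset.mem_range.1 hjm)).1, (hj j (Finset.mem_range.1 hjm)).2, Complex.re_add_im]

/-- The search halts with an accepted vector as soon as there is one. -/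
theorem computes_searchProgram (h : ∃ k w, w < k ^ 4 ∧ Accepts D (tol D.α D.β n) k w) :
    ∃ k w, Accepts D (tol D.α D.β n) k w ∧ Computes searchProgram D n (codeVec k w) := by
  set ε := tol D.α D.β n with hε
  have run : Ensures D searchProgram (initMem n) fun t =>
      ∃ k w, Accepts D ε k w ∧ output t = codeVec k w := by
    have htol : Ensures D toleranceProgram (initMem n) (TrialState 0 0 ε) := by
      refine .ite (fun h => .setReal ?_) (fun h => .setReal ?_)
      all_goals
        simp only [Test.holds, RealExp.eval, NatExp.eval, initMem, Function.update_self,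
          Nat.cast_zero] at h
        simp [TrialState, hε, tol, h, RealExp.eval, NatExp.eval, initMem, invSuccExp]
    refine .seq <| htol.mono fun s hs => .seq <| (ensures_trialProgram hs).mono fun s hs =>
      .seq <| (Ensures.whileLoop
        (fun m t => TrialState (nextPair^[m] (0, 0)).1 (nextPair^[m] (0, 0)).2 ε t ∧
          t.real 2 = sqResidual D (nextPair^[m] (0, 0)).1 (nextPair^[m] (0, 0)).2 ∧
          t.real 3 = ∑ j ∈ Finset.range (dim (nextPair^[m] (0, 0)).1 (nextPair^[m] (0, 0)).2),
            ‖coord (nextPair^[m] (0, 0)).1 (nextPair^[m] (0, 0)).2 j‖ ^ 2)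
        (fun m => Accepts D ε (nextPair^[m] (0, 0)).1 (nextPair^[m] (0, 0)).2)
        ?_ ?_ ?_ hs).mono ?_
    · obtain ⟨k, w, hw, hacc⟩ := h
      obtain ⟨m, hm⟩ := exists_iterate_nextPair hw
      exact ⟨m, by rwa [hm]⟩
    · rintro m t ⟨ht, h2, h3⟩
      exact not_congr (holds_acceptTest ht h2 h3)
    · rintro m t - ⟨ht, -, -⟩
      rw [Function.iterate_succ_apply']
      exact .seq <| (ensures_nextProgram ht).mono fun u hu => ensures_trialProgram hu
    · rintro t ⟨m, hacc, ht, -, -⟩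
      exact (ensures_outputProgram ht).mono fun u hu => ⟨_, _, hacc, hu⟩
  obtain ⟨t, ht, k, w, hacc, hout⟩ := run
  exact ⟨k, w, hacc, t, ht, hout⟩

end Semantics

/-! ### The resolvent of a self-adjoint operator -/

section Resolvent

variable {T : Ell2 →ₗ.[ℂ] Ell2} {z : ℂ}

theorem formalAdjoint_self (hT : IsSelfAdjoint T) (u v : T.domain) :
    inner ℂ (T u) (v : Ell2) = inner ℂ (u : Ell2) (T v) := by
  have h := LinearPMap.adjoint_isFormalAdjoint hT.dense_domain
  rw [LinearPMap.isSelfAdjoint_def.1 hT] at h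
  exact h u v

theorem im_inner_self (hT : IsSelfAdjoint T) (u : T.domain) :
    (inner ℂ (u : Ell2) (T u)).im = 0 := by
  rw [← Complex.conj_eq_iff_im, inner_conj_symm, formalAdjoint_self hT]

theorem abs_im_mul_norm_le (hT : IsSelfAdjoint T) (u : T.domain) :
    |z.im| * ‖(u : Ell2)‖ ≤ ‖T u - z • (u : Ell2)‖ := by
  rcases eq_or_ne (u : Ell2) 0 with hu | hu
  · simp [hu]
  have h1 : (inner ℂ (u : Ell2) (T u - z • (u : Ell2))).im = -(z.im * ‖(u : Ell2)‖ ^ 2) := by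
    rw [inner_sub_right, inner_smul_right, inner_self_eq_norm_sq_to_K, Complex.sub_im,
      im_inner_self hT]
    have : ((‖(u : Ell2)‖ : ℂ)) ^ 2 = ((‖(u : Ell2)‖ ^ 2 : ℝ) : ℂ) := by push_cast; rfl
    simp only [Complex.coe_algebraMap, this, Complex.im_mul_ofReal, zero_sub]
  have h2 : |z.im| * ‖(u : Ell2)‖ ^ 2 ≤ ‖(u : Ell2)‖ * ‖T u - z • (u : Ell2)‖ := by
    calc |z.im| * ‖(u : Ell2)‖ ^ 2 = |(inner ℂ (u : Ell2) (T u - z • (u : Ell2))).im| := by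
          rw [h1, abs_neg, abs_mul, abs_of_nonneg (sq_nonneg ‖(u : Ell2)‖)]
      _ ≤ ‖inner ℂ (u : Ell2) (T u - z • (u : Ell2))‖ := Complex.abs_im_le_norm _
      _ ≤ _ := norm_inner_le_norm _ _
  have h3 : 0 < ‖(u : Ell2)‖ := norm_pos_iff.2 hu
  refine le_of_mul_le_mul_left ?_ h3
  linarith

/-- The linear map `u ↦ T u - z u` on the domain of `T`. -/
noncomputable def shift (T : Ell2 →ₗ.[ℂ] Ell2) (z : ℂ) : T.domain →ₗ[ℂ] Ell2 :=
  T.toFun - z • T.domain.subtype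

theorem shift_apply (u : T.domain) : shift T z u = T u - z • (u : Ell2) := rfl

theorem isClosed_range_shift (hT : IsSelfAdjoint T) (hz : z.im ≠ 0) :
    IsClosed (LinearMap.range (shift T z) : Set Ell2) := by
  refine isClosed_of_closure_subset fun y hy => ?_
  obtain ⟨v, hv, hlim⟩ := mem_closure_iff_seq_limit.1 hy
  choose u hu using hv
  have hz' : 0 < |z.im| := abs_pos.2 hz
  have hcauchy : CauchySeq fun n => (u n : Ell2) := by
    rw [Metric.cauchySeq_iff']
    intro ε hε
    obtain ⟨N, hN⟩ := Metric.cauchySeq_iff'.1 hlim.cauchySeq (|z.im| * ε) (mul_pos hz' hε)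
    refine ⟨N, fun n hn => ?_⟩
    have h1 := hN n hn
    have h2 := abs_im_mul_norm_le (z := z) hT (u n - u N)
    rw [← shift_apply, map_sub, hu, hu, Submodule.coe_sub] at h2
    rw [dist_eq_norm] at h1 ⊢
    exact lt_of_mul_lt_mul_left (h2.trans_lt h1) hz'.le
  obtain ⟨x, hx⟩ := cauchySeq_tendsto_of_complete hcauchy
  have hTu : Tendsto (fun n => T (u n)) atTop (𝓝 (y + z • x)) := by
    have : (fun n => T (u n)) = fun n => v n + z • (u n : Ell2) := by
      funext n; rw [← hu, shift_apply]; abel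
    rw [this]
    exact hlim.add (hx.const_smul z)
  have hgraph : (x, y + z • x) ∈ T.graph :=
    hT.isClosed.mem_of_tendsto (hx.prodMk_nhds hTu)
      (Eventually.of_forall fun n => T.mem_graph (u n))
  obtain ⟨w, hw, hTw⟩ := T.mem_graph_iff.1 hgraph
  exact ⟨w, by rw [shift_apply, hTw, hw]; simp⟩

theorem range_shift (hT : IsSelfAdjoint T) (hz : z.im ≠ 0) :
    LinearMap.range (shift T z) = ⊤ := by
  have hcl := isClosed_range_shift hT hz
  have : CompleteSpace (LinearMap.range (shift T z)) := hcl.completeSpace_coe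
  rw [← Submodule.orthogonal_eq_bot_iff, Submodule.eq_bot_iff]
  intro v hv
  -- A vector orthogonal to the range is an eigenvector of the adjoint, hence of `T`, with
  -- eigenvalue `conj z`.
  have hv' : ∀ u : T.domain, inner ℂ ((starRingEnd ℂ) z • v) (u : Ell2) = inner ℂ v (T u) := by
    intro u
    have h := (Submodule.mem_orthogonal' _ _).1 hv _ ⟨u, rfl⟩
    rw [shift_apply, inner_sub_right, sub_eq_zero, inner_smul_right] at h
    rw [inner_smul_left, h, Complex.conj_conj]
  have hadj := T.mem_adjoint_domain_of_exists v ⟨_, hv'⟩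
  have heig := LinearPMap.adjoint_apply_eq hT.dense_domain ⟨v, hadj⟩ hv'
  obtain ⟨w, hw, hTw⟩ : ∃ w : T.domain, (w : Ell2) = v ∧ T w = (starRingEnd ℂ) z • v := by
    have hg : (v, (starRingEnd ℂ) z • v) ∈ T.adjoint.graph :=
      T.adjoint.mem_graph_iff.2 ⟨⟨v, hadj⟩, rfl, heig⟩
    rw [LinearPMap.isSelfAdjoint_def.1 hT] at hg
    exact T.mem_graph_iff.1 hg
  have hle := abs_im_mul_norm_le (z := (starRingEnd ℂ) z) hT w
  rw [hTw, hw, sub_self, norm_zero, Complex.conj_im, abs_neg] at hle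
  have : ‖v‖ ≤ 0 := nonpos_of_mul_nonpos_right hle (abs_pos.2 hz)
  exact norm_le_zero_iff.1 this

theorem mem_resolventPoints (hT : IsSelfAdjoint T) (hz : z.im ≠ 0) : z ∈ resolventPoints T := by
  have hz' : 0 < |z.im| := abs_pos.2 hz
  have hinj : Function.Injective (shift T z) := by
    rw [injective_iff_map_eq_zero]
    intro u hu
    have hle := abs_im_mul_norm_le (z := z) hT u
    rw [← shift_apply, hu, norm_zero] at hle
    exact Subtype.ext (norm_le_zero_iff.1 (nonpos_of_mul_nonpos_right hle hz'))
  let E := LinearEquiv.ofBijective (shift T z) ⟨hinj, LinearMap.range_eq_top.1 (range_shift hT hz)⟩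
  have hE : ∀ u, E u = T u - z • (u : Ell2) := fun u => rfl
  refine ⟨(T.domain.subtype ∘ₗ E.symm.toLinearMap).mkContinuous |z.im|⁻¹ fun y => ?_,
    fun y => ⟨(E.symm y).2, ?_⟩, fun u => ?_⟩
  · have hle := abs_im_mul_norm_le (z := z) hT (E.symm y)
    rw [← hE, E.apply_symm_apply] at hle
    rw [inv_mul_eq_div, le_div_iff₀ hz', mul_comm]
    exact hle
  · exact (hE _).symm.trans (E.apply_symm_apply y)
  · exact congrArg Subtype.val (E.symm_apply_apply u)

theorem isResolventAt_Res (hT : IsSelfAdjoint T) (hz : z.im ≠ 0) :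
    IsResolventAt T z (Res z T) := by
  have h : ∃ R : Ell2 →L[ℂ] Ell2, IsResolventAt T z R := mem_resolventPoints hT hz
  rw [Res, dif_pos h]
  exact h.choose_spec

/-- The residual of an approximate solution of `(T - z) u = x` controls the error. -/
theorem norm_sub_Res_le (hT : IsSelfAdjoint T) (hz : z.im ≠ 0) (x : Ell2) (u : T.domain) :
    ‖(u : Ell2) - Res z T x‖ ≤ ‖T u - z • (u : Ell2) - x‖ / |z.im| := by
  obtain ⟨hd, hx⟩ := (isResolventAt_Res hT hz).1 x
  have h := abs_im_mul_norm_le (z := z) hT (u - ⟨Res z T x, hd⟩)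
  rw [le_div_iff₀ (abs_pos.2 hz), mul_comm]
  refine h.trans_eq (congrArg norm ?_)
  rw [← shift_apply, map_sub, shift_apply, shift_apply, hx]

/-- Since the finite linear combinations form a core, their images under `T - z` come arbitrarily
close to every vector. -/
theorem exists_finSpan_residual_lt (hT : T ∈ OmegaSA) (hz : z.im ≠ 0) (x : Ell2) {ε : ℝ}
    (hε : 0 < ε) : ∃ u : T.domain, (u : Ell2) ∈ finSpan ∧ ‖T u - z • (u : Ell2) - x‖ < ε := by
  obtain ⟨hd, hx⟩ := (isResolventAt_Res hT.2 hz).1 x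
  have hclos : (T.domRestrict finSpan).IsClosable :=
    hT.1.closed.isClosable.leIsClosable LinearPMap.domRestrict_le
  have hmem : (Res z T x, T ⟨Res z T x, hd⟩) ∈
      closure ((T.domRestrict finSpan).graph : Set (Ell2 × Ell2)) := by
    rw [← Submodule.topologicalClosure_coe, hclos.graph_closure_eq_closure_graph,
      hT.1.core.closure_eq]
    exact T.mem_graph ⟨Res z T x, hd⟩
  have hopen : IsOpen {p : Ell2 × Ell2 | ‖p.2 - z • p.1 - x‖ < ε} :=
    isOpen_lt (by fun_prop) continuous_const
  obtain ⟨p, hp, hpg⟩ := mem_closure_iff.1 hmem _ hopen (by simpa [hx] using hε)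
  obtain ⟨u, hu1, hu2⟩ := LinearPMap.mem_graph_iff _ |>.1 hpg
  have hu : (u : Ell2) ∈ finSpan ⊓ T.domain := u.2
  refine ⟨⟨u, hu.2⟩, hu.1, ?_⟩
  have h2 : T ⟨u, hu.2⟩ = p.2 := by
    rw [← hu2]
    exact (LinearPMap.domRestrict_apply (x := u) (y := ⟨(u : Ell2), hu.2⟩) rfl).symm
  change ‖T ⟨u, hu.2⟩ - z • (u : Ell2) - x‖ < ε
  rw [h2, hu1]
  exact hp

end Resolvent

/-! ### Finite sections -/

theorem e_apply (i j : ℕ) : (e i : ℕ → ℂ) j = if j = i then 1 else 0 := by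
  simp [e, Pi.single_apply]

theorem inner_e (i : ℕ) (v : Ell2) : inner ℂ (e i) v = v i := by
  rw [e, lp.inner_single_left]; simp

theorem P_apply (m : ℕ) (v : Ell2) : P m v = ∑ i ∈ Finset.range m, v i • e i := by
  simp [P, inner_e]

theorem norm_sq_sum_smul_e (m : ℕ) (a : ℕ → ℂ) :
    ‖∑ i ∈ Finset.range m, a i • e i‖ ^ 2 = ∑ i ∈ Finset.range m, ‖a i‖ ^ 2 := by
  have h := lp.norm_sum_single (p := 2) (E := fun _ : ℕ => ℂ) (by norm_num) a (Finset.range m)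
  have he : ∀ i, a i • e i = lp.single 2 i (a i) := fun i => by
    rw [e, ← lp.single_smul, smul_eq_mul, mul_one]
  simp only [he]
  simpa using h

theorem norm_P_sq (m : ℕ) (v : Ell2) : ‖P m v‖ ^ 2 = ∑ i ∈ Finset.range m, ‖v i‖ ^ 2 := by
  rw [P_apply, norm_sq_sum_smul_e]

theorem norm_P_sub_le (m : ℕ) (v : Ell2) : ‖P m v - v‖ ≤ ‖v‖ := by
  have hv : inner ℂ (P m v) v = (‖P m v‖ ^ 2 : ℝ) := by
    rw [norm_P_sq, P_apply, sum_inner]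
    push_cast
    refine Finset.sum_congr rfl fun i _ => ?_
    rw [inner_smul_left, inner_e, Complex.conj_mul']
  have h := norm_sub_sq (𝕜 := ℂ) (P m v) v
  rw [hv] at h
  have h' : ‖P m v - v‖ ^ 2 = ‖v‖ ^ 2 - ‖P m v‖ ^ 2 := by
    rw [h, RCLike.re_eq_complex_re, Complex.ofReal_re]; ring
  exact le_of_sq_le_sq (by nlinarith [sq_nonneg ‖P m v‖]) (norm_nonneg _)

theorem sum_smul_e_apply (m : ℕ) (a : ℕ → ℂ) (i : ℕ) :
    ((∑ j ∈ Finset.range m, a j • e j : Ell2) : ℕ → ℂ) i = if i < m then a i else 0 := by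
  rw [lp.coeFn_sum, Finset.sum_apply]
  simp [e_apply]

theorem P_sum_smul_e {l m : ℕ} (h : l ≤ m) (a : ℕ → ℂ) :
    P m (∑ j ∈ Finset.range l, a j • e j) = ∑ j ∈ Finset.range l, a j • e j := by
  ext i
  rw [P_apply, sum_smul_e_apply, sum_smul_e_apply]
  split_ifs <;> first | rfl | omega

theorem norm_P_sub_anti {l m : ℕ} (h : l ≤ m) (v : Ell2) : ‖P m v - v‖ ≤ ‖P l v - v‖ := by
  have h1 : P m (P l v) = P l v := by rw [P_apply l]; exact P_sum_smul_e h _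
  have h2 : P m (P l v - v) - (P l v - v) = -(P m v - v) := by rw [map_sub, h1]; abel
  rw [← norm_neg (P m v - v), ← h2]
  exact norm_P_sub_le m _

theorem norm_P_le (m : ℕ) (v : Ell2) : ‖P m v‖ ≤ ‖v‖ := by
  refine le_of_sq_le_sq ?_ (norm_nonneg _)
  have h := lp.sum_rpow_le_norm_rpow (p := 2) (E := fun _ : ℕ => ℂ) (by norm_num) v
    (Finset.range m)
  rw [norm_P_sq]
  simpa using h

theorem firstCols_sum_smul_e (T : Ell2 →ₗ.[ℂ] Ell2) {l m : ℕ} (h : l ≤ m) (a : ℕ → ℂ) :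
    firstCols T m (∑ j ∈ Finset.range l, a j • e j) =
      ∑ j ∈ Finset.range l, a j • app T (e j) := by
  simp only [firstCols, sum_apply, ContinuousLinearMap.smulRight_apply, innerSL_apply_apply,
    inner_e, sum_smul_e_apply, ite_smul, zero_smul]
  rw [← Finset.sum_filter]
  congr 1
  ext j
  simp only [Finset.mem_filter, Finset.mem_range]
  omega

/-- The residual of the vector with coordinates `a j`, `j < m`, in the equation
`(T - z) u = x`. -/
noncomputable def residual (T : Ell2 →ₗ.[ℂ] Ell2) (z : ℂ) (x : Ell2) (m : ℕ) (a : ℕ → ℂ) : Ell2 :=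
  ∑ j ∈ Finset.range m, a j • (app T (e j) - z • e j) - x

theorem residual_eq (T : Ell2 →ₗ.[ℂ] Ell2) (z : ℂ) (x : Ell2) (m : ℕ) (a : ℕ → ℂ) :
    residual T z x m a = ∑ j ∈ Finset.range m, a j • app T (e j) -
      z • ∑ j ∈ Finset.range m, a j • e j - x := by
  simp only [residual, smul_sub, Finset.sum_sub_distrib, Finset.smul_sum, smul_comm z]

section Domain

variable {T : Ell2 →ₗ.[ℂ] Ell2}

theorem e_mem_domain (hT : T ∈ OmegaSA) (j : ℕ) : e j ∈ T.domain :=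
  hT.1.core.le_domain (Submodule.subset_span ⟨j, rfl⟩)

theorem sum_smul_e_mem_domain (hT : T ∈ OmegaSA) (m : ℕ) (a : ℕ → ℂ) :
    ∑ j ∈ Finset.range m, a j • e j ∈ T.domain :=
  Submodule.sum_mem _ fun j _ => Submodule.smul_mem _ _ (e_mem_domain hT j)

theorem map_sum_smul_e (hT : T ∈ OmegaSA) (m : ℕ) (a : ℕ → ℂ) :
    T ⟨_, sum_smul_e_mem_domain hT m a⟩ = ∑ j ∈ Finset.range m, a j • app T (e j) := by
  have h : (⟨_, sum_smul_e_mem_domain hT m a⟩ : T.domain) =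
      ∑ j ∈ Finset.range m, a j • (⟨e j, e_mem_domain hT j⟩ : T.domain) :=
    Subtype.ext (by simp)
  rw [h, ← LinearPMap.toFun_eq_coe, map_sum]
  refine Finset.sum_congr rfl fun j _ => ?_
  rw [map_smul, LinearPMap.toFun_eq_coe, app, dif_pos (e_mem_domain hT j)]

theorem norm_sum_smul_e_sub_Res_le (hT : T ∈ OmegaSA) {z : ℂ} (hz : z.im ≠ 0) (x : Ell2) (m : ℕ)
    (a : ℕ → ℂ) : ‖∑ j ∈ Finset.range m, a j • e j - Res z T x‖ ≤
      ‖residual T z x m a‖ / |z.im| := by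
  have h := norm_sub_Res_le hT.2 hz x ⟨_, sum_smul_e_mem_domain hT m a⟩
  rwa [map_sum_smul_e hT, ← residual_eq] at h

theorem exists_eq_sum_smul_e {v : Ell2} (hv : v ∈ finSpan) :
    ∃ (m : ℕ) (a : ℕ → ℂ), v = ∑ j ∈ Finset.range m, a j • e j := by
  obtain ⟨c, rfl⟩ := Finsupp.mem_span_range_iff_exists_finsupp.1 hv
  refine ⟨c.support.sup id + 1, c, Finset.sum_subset (fun j hj => ?_) fun j _ hj => ?_⟩
  · exact Finset.mem_range.2 (Nat.lt_succ_of_le (Finset.le_sup (f := id) hj))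
  · simp [Finsupp.notMem_support_iff.1 hj]

theorem exists_norm_residual_lt (hT : T ∈ OmegaSA) {z : ℂ} (hz : z.im ≠ 0) (x : Ell2) {ε : ℝ}
    (hε : 0 < ε) : ∃ (m : ℕ) (a : ℕ → ℂ), ‖residual T z x m a‖ < ε := by
  obtain ⟨⟨u, hu⟩, hspan, hlt⟩ := exists_finSpan_residual_lt hT hz x hε
  obtain ⟨m, a, rfl⟩ := exists_eq_sum_smul_e hspan
  exact ⟨m, a, by rwa [residual_eq, ← map_sum_smul_e hT]⟩

end Domain

/-! ### Density of the coded vectors -/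

theorem exists_betaTerm_eq (p : ℕ → ℕ) (L : ℕ) : ∃ c d, ∀ i < L, betaTerm c d i = p i := by
  refine ⟨(Nat.unbeta ((List.range L).map p)).unpair.1,
    (Nat.unbeta ((List.range L).map p)).unpair.2, fun i hi => ?_⟩
  have h := Nat.beta_unbeta_coe ((List.range L).map p) ⟨i, by simpa using hi⟩
  simpa [Nat.beta, betaTerm] using h

/-- Every code `(c, d, q)` in dimension `m` belongs to some `w < k ^ 4`, for all large `k`. -/
theorem exists_digits {c d q m k : ℕ} (hc : c < k) (hd : d < k) (hq : q < k) (hm : m < k) :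
    ∃ w < k ^ 4, dim k w = m ∧ ∀ j, coord k w j = ⟨coordRe c d q j, coordIm c d q j⟩ := by
  have digit : ∀ r t : ℕ, r < k → (r + k * t) % k = r ∧ (r + k * t) / k = t := fun r t hr =>
    ⟨by rw [Nat.add_mul_mod_self_left, Nat.mod_eq_of_lt hr],
      by rw [Nat.add_mul_div_left _ _ (by omega), Nat.div_eq_of_lt hr, Nat.zero_add]⟩
  have bound : ∀ r t l : ℕ, r < k → t < k ^ l → r + k * t < k ^ (l + 1) := fun r t l hr ht => by
    calc r + k * t < k * (t + 1) := by rw [mul_add]; omega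
      _ ≤ k * k ^ l := Nat.mul_le_mul_left _ ht
      _ = k ^ (l + 1) := (pow_succ' k l).symm
  refine ⟨c + k * (d + k * (q + k * m)),
    bound _ _ _ hc (bound _ _ _ hd (bound _ _ _ hq (by simpa using hm))), ?_, fun j => ?_⟩
  · rw [dim, (digit _ _ hc).2, (digit _ _ hd).2, (digit _ _ hq).2]
  · rw [coord, (digit _ _ hc).2, (digit _ _ hd).2, (digit _ _ hc).1, (digit _ _ hd).1,
      (digit _ _ hq).1]

/-- Numerators of the approximation with denominator `q + 1` of the vector `a`: the positive and
negative parts of the real and imaginary part of each coordinate, rounded down. -/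
noncomputable def numerator (a : ℕ → ℂ) (q i : ℕ) : ℕ :=
  let t : ℝ := match i % 4 with
    | 0 => (a (i / 4)).re⁺
    | 1 => (a (i / 4)).re⁻
    | 2 => (a (i / 4)).im⁺
    | _ => (a (i / 4)).im⁻
  ⌊t * ((q + 1 : ℕ) : ℝ)⌋₊

/-- The approximation with denominator `q + 1` of the vector `a`. -/
noncomputable def approx (a : ℕ → ℂ) (q j : ℕ) : ℂ :=
  ⟨((numerator a q (4 * j) : ℝ) - numerator a q (4 * j + 1)) / ((q + 1 : ℕ) : ℝ),
    ((numerator a q (4 * j + 2) : ℝ) - numerator a q (4 * j + 3)) / ((q + 1 : ℕ) : ℝ)⟩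

theorem tendsto_approx (a : ℕ → ℂ) (j : ℕ) : Tendsto (fun q => approx a q j) atTop (𝓝 (a j)) := by
  have key : ∀ t : ℝ, Tendsto (fun q : ℕ => ((⌊t⁺ * ((q + 1 : ℕ) : ℝ)⌋₊ : ℝ) -
      (⌊t⁻ * ((q + 1 : ℕ) : ℝ)⌋₊ : ℝ)) / ((q + 1 : ℕ) : ℝ)) atTop (𝓝 t) := by
    intro t
    have hq : Tendsto (fun q : ℕ => ((q + 1 : ℕ) : ℝ)) atTop atTop :=
      tendsto_natCast_atTop_atTop.comp (tendsto_add_atTop_nat 1)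
    have h := ((tendsto_nat_floor_mul_div_atTop (posPart_nonneg t)).comp hq).sub
      ((tendsto_nat_floor_mul_div_atTop (negPart_nonneg t)).comp hq)
    rw [posPart_sub_negPart] at h
    refine h.congr fun q => ?_
    simp only [Function.comp_apply, sub_div]
  have h0 : (4 * j) % 4 = 0 ∧ (4 * j) / 4 = j := by omega
  have h1 : (4 * j + 1) % 4 = 1 ∧ (4 * j + 1) / 4 = j := by omega
  have h2 : (4 * j + 2) % 4 = 2 ∧ (4 * j + 2) / 4 = j := by omega
  have h3 : (4 * j + 3) % 4 = 3 ∧ (4 * j + 3) / 4 = j := by omega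
  have h := (Complex.continuous_ofReal.tendsto _).comp (key (a j).re) |>.add
    (((Complex.continuous_ofReal.tendsto _).comp (key (a j).im)).mul_const Complex.I)
  rw [Complex.re_add_im] at h
  refine h.congr fun q => ?_
  simp only [approx, numerator, h0, h1, h2, h3, Function.comp_apply]
  exact (Complex.mk_eq_add_mul_I _ _).symm

theorem exists_code (T : Ell2 →ₗ.[ℂ] Ell2) (z : ℂ) (x : Ell2) {ε : ℝ} {m : ℕ} {a : ℕ → ℂ}
    (h : ‖residual T z x m a‖ < ε) :
    ∃ (b : ℕ → ℂ) (K : ℕ), ‖residual T z x m b‖ < ε ∧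
      ∀ k ≥ K, ∃ w < k ^ 4, dim k w = m ∧ ∀ j < m, coord k w j = b j := by
  have hlim : Tendsto (fun q => residual T z x m (approx a q)) atTop (𝓝 (residual T z x m a)) :=
    (tendsto_finsetSum _ fun j _ => (tendsto_approx a j).smul_const _).sub_const x
  obtain ⟨q, hq⟩ := (hlim.norm.eventually_lt_const h).exists
  obtain ⟨c, d, hcd⟩ := exists_betaTerm_eq (numerator a q) (4 * m)
  refine ⟨approx a q, c + d + q + m + 1, hq, fun k hk => ?_⟩
  obtain ⟨w, hw, hdim, hcoord⟩ := exists_digits (c := c) (d := d) (q := q) (m := m) (k := k)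
    (by omega) (by omega) (by omega) (by omega)
  refine ⟨w, hw, hdim, fun j hj => ?_⟩
  rw [hcoord, coordRe, coordIm, hcd _ (by omega), hcd _ (by omega), hcd _ (by omega),
    hcd _ (by omega), approx]

/-! ### Acceptance and the error bound -/

theorem tol_pos (α β : ℕ → ℝ) (n : ℕ) : 0 < tol α β n := by
  unfold tol
  split_ifs with h
  · exact h
  · positivity

theorem tol_eq {α β : ℕ → ℝ} {n : ℕ} (h : 0 < α n + β n) : tol α β n = α n + β n := if_pos h

theorem tendsto_inv_succ : Tendsto (fun n : ℕ => 1 / ((n + 1 : ℕ) : ℝ)) atTop (𝓝 0) := by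
  simpa using tendsto_one_div_add_atTop_nhds_zero_nat (𝕜 := ℝ)

section Acceptance

variable {f : ℕ → ℕ} {α β : ℕ → ℝ} {T : Ell2 →ₗ.[ℂ] Ell2} {x : Ell2} {z : ℂ}

theorem tendsto_tol (hα : ∀ n, 0 ≤ α n) (hβ : ∀ n, 0 ≤ β n) (hα0 : Tendsto α atTop (𝓝 0))
    (hβ0 : Tendsto β atTop (𝓝 0)) : Tendsto (tol α β) atTop (𝓝 0) := by
  have h : Tendsto (fun n => α n + β n + 1 / ((n + 1 : ℕ) : ℝ)) atTop (𝓝 0) := by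
    simpa using (hα0.add hβ0).add tendsto_inv_succ
  refine squeeze_zero (fun n => (tol_pos α β n).le) (fun n => ?_) h
  have h1 : (0 : ℝ) < 1 / ((n + 1 : ℕ) : ℝ) := by positivity
  unfold tol
  split_ifs
  · exact le_add_of_nonneg_right h1.le
  · exact le_add_of_nonneg_left (add_nonneg (hα n) (hβ n))

theorem sqResidual_oracle (k w : ℕ) :
    sqResidual (oracle f α β T x z) k w =
      ‖P (f k) (residual T z x (dim k w) (coord k w))‖ ^ 2 := by
  rw [norm_P_sq]
  refine Finset.sum_congr rfl fun i _ => ?_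
  rw [residual, lp.coeFn_sub, Pi.sub_apply, lp.coeFn_sum, Finset.sum_apply]
  simp only [shiftEntry, oracle, inner_e, lp.coeFn_smul, lp.coeFn_sub, Pi.smul_apply, Pi.sub_apply,
    e_apply, smul_eq_mul]
  congr 3
  refine Finset.sum_congr rfl fun j _ => ?_
  ring

/-- A bound up to constants, valid for large indices, holds for all indices once the bounding
sequence is made positive. -/
theorem exists_bound_add_inv_succ {g : ℕ → ℝ} (hα : ∀ n, 0 ≤ α n) (h : g =O[atTop] α) :
    ∃ C, 0 ≤ C ∧ ∀ n, |g n| ≤ C * (α n + 1 / ((n + 1 : ℕ) : ℝ)) := by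
  have hpos : ∀ n, 0 < α n + 1 / ((n + 1 : ℕ) : ℝ) := fun n =>
    add_pos_of_nonneg_of_pos (hα n) (by positivity)
  have h' : g =O[atTop] fun n => α n + 1 / ((n + 1 : ℕ) : ℝ) := by
    refine h.trans (Asymptotics.IsBigO.of_bound 1 (Eventually.of_forall fun n => ?_))
    rw [Real.norm_of_nonneg (hα n), Real.norm_of_nonneg (hpos n).le, one_mul]
    exact le_add_of_nonneg_right (by positivity)
  obtain ⟨C, hC, hle⟩ := Asymptotics.bound_of_isBigO_nat_atTop h'
  refine ⟨C, hC.le, fun n => ?_⟩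
  simpa only [Real.norm_eq_abs, abs_of_pos (hpos n)] using hle (hpos n).ne'

theorem exists_accepts (hα0 : Tendsto α atTop (𝓝 0)) (hβ0 : Tendsto β atTop (𝓝 0))
    (hT : T ∈ OmegaSA) (hz : z.im ≠ 0) {ε : ℝ} (hε : 0 < ε) :
    ∃ k w, w < k ^ 4 ∧ Accepts (oracle f α β T x z) ε k w := by
  obtain ⟨m, a, ha⟩ := exists_norm_residual_lt hT hz x hε
  obtain ⟨b, K, hb, hcode⟩ := exists_code T z x ha
  have h1 : Tendsto (fun k => (α k + 1 / ((k + 1 : ℕ) : ℝ)) ^ 2 *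
      ∑ j ∈ Finset.range m, ‖b j‖ ^ 2) atTop (𝓝 0) := by
    simpa using ((hα0.add tendsto_inv_succ).pow 2).mul_const (∑ j ∈ Finset.range m, ‖b j‖ ^ 2)
  have h2 : Tendsto (fun k => β k + 1 / ((k + 1 : ℕ) : ℝ)) atTop (𝓝 0) := by
    simpa using hβ0.add tendsto_inv_succ
  obtain ⟨k, hk1, hk2, hkK, hkm⟩ := ((h1.eventually_lt_const (pow_pos hε 2)).and
    ((h2.eventually_lt_const hε).and
      ((eventually_ge_atTop K).and (eventually_ge_atTop m)))).exists
  obtain ⟨w, hw, hdim, hcoord⟩ := hcode k hkK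
  refine ⟨k, w, hw, hdim.trans_le hkm, ?_, ?_, hk2⟩
  · have hres : residual T z x (dim k w) (coord k w) = residual T z x m b := by
      rw [hdim, residual, residual]
      congr 1
      exact Finset.sum_congr rfl fun j hj => by rw [hcoord j (Finset.mem_range.1 hj)]
    rw [sqResidual_oracle, hres]
    exact pow_lt_pow_left₀ ((norm_P_le _ _).trans_lt hb) (norm_nonneg _) two_ne_zero
  · rw [hdim, Finset.sum_congr rfl fun j hj => by rw [hcoord j (Finset.mem_range.1 hj)]]
    exact hk1

/-- The constant depends on `T` and `x` only: it is uniform in the spectral parameter and the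
tolerance. -/
theorem exists_norm_residual_le_of_accepts (hf : ∀ n, n < f n) (hα : ∀ n, 0 ≤ α n)
    (hβ : ∀ n, 0 ≤ β n) (hA : (T, x) ∈ Omega f α β) :
    ∃ C, ∀ (z : ℂ) (ε : ℝ) (k w : ℕ), 0 < ε → Accepts (oracle f α β T x z) ε k w →
      ‖residual T z x (dim k w) (coord k w)‖ ≤ C * ε := by
  obtain ⟨-, hOα, hOβ⟩ := hA
  obtain ⟨C₁, hC₁, h₁⟩ := exists_bound_add_inv_succ hα hOα
  obtain ⟨C₂, hC₂, h₂⟩ := exists_bound_add_inv_succ hβ hOβ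
  refine ⟨1 + C₁ + C₂, fun z ε k w hε ⟨hdim, hres, hvec, htail⟩ => ?_⟩
  rw [sqResidual_oracle] at hres
  rw [← norm_sq_sum_smul_e, ← mul_pow] at hvec
  set y : Ell2 := ∑ j ∈ Finset.range (dim k w), coord k w j • e j with hy
  set r := residual T z x (dim k w) (coord k w) with hr
  simp only [oracle] at hvec htail
  -- The part of the residual outside the section consists of columns of `T` and the tail of `x`,
  -- because the section contains the support of `y`.
  have hPy : P (f k) y = y := P_sum_smul_e (hdim.trans (hf k).le) _
  have hsplit : P (f k) r - r =
      (P (f k) - ContinuousLinearMap.id ℂ Ell2).comp (firstCols T k) y - (P (f k) x - x) := by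
    rw [ContinuousLinearMap.comp_apply, hy, firstCols_sum_smul_e T hdim, hr, residual_eq, ← hy,
      map_sub, map_sub, map_smul, hPy, sub_apply, ContinuousLinearMap.id_apply]
    abel
  have hin : ‖P (f k) r‖ ≤ ε := (lt_of_pow_lt_pow_left₀ 2 hε.le hres).le
  have hcols : ‖(P (f k) - ContinuousLinearMap.id ℂ Ell2).comp (firstCols T k) y‖ ≤ C₁ * ε := by
    refine (ContinuousLinearMap.le_opNorm _ _).trans ?_
    have h := h₁ k
    rw [abs_of_nonneg (norm_nonneg _)] at h
    calc _ ≤ C₁ * (α k + 1 / ((k + 1 : ℕ) : ℝ)) * ‖y‖ := by gcongr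
      _ = C₁ * ((α k + 1 / ((k + 1 : ℕ) : ℝ)) * ‖y‖) := mul_assoc _ _ _
      _ ≤ C₁ * ε := by
        gcongr
        exact (lt_of_pow_lt_pow_left₀ 2 hε.le hvec).le
  have htl : ‖P (f k) x - x‖ ≤ C₂ * ε := by
    refine (norm_P_sub_anti (hf k).le x).trans ?_
    have h := h₂ k
    rw [abs_of_nonneg (norm_nonneg _)] at h
    exact h.trans (by gcongr)
  calc ‖r‖ = ‖P (f k) r - (P (f k) r - r)‖ := by rw [sub_sub_cancel]
    _ ≤ ‖P (f k) r‖ + ‖P (f k) r - r‖ := norm_sub_le _ _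
    _ ≤ ε + (C₁ * ε + C₂ * ε) := by
      refine add_le_add hin ?_
      rw [hsplit]
      exact (norm_sub_le _ _).trans (add_le_add hcols htl)
    _ = (1 + C₁ + C₂) * ε := by ring

end Acceptance

theorem finite_support_codeVec (k w : ℕ) : (Function.support (codeVec k w : ℕ → ℂ)).Finite := by
  refine (Finset.range (dim k w)).finite_toSet.subset fun i hi => ?_
  rw [Function.mem_support, codeVec, sum_smul_e_apply] at hi
  simpa using fun h => hi (if_neg (not_lt.2 h))

end SCI

theorem corollary2p2 :
    ∃ M : SCI.Program,
      ∀ (f : ℕ → ℕ) (α β : ℕ → ℝ), (∀ n, n < f n) →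
        (∀ n, 0 ≤ α n) → (∀ n, 0 ≤ β n) →
        Tendsto α atTop (𝓝 0) → Tendsto β atTop (𝓝 0) →
        ∃ Γ : ℕ → SCI.Omega f α β → {z : ℂ // z.im ≠ 0} → SCI.Ell2,
          (∀ (n : ℕ) (A : SCI.Omega f α β) (z : {z : ℂ // z.im ≠ 0}),
            SCI.Computes M (SCI.oracle f α β A.1.1 A.1.2 z) n (Γ n A z)) ∧
          (∀ (A : SCI.Omega f α β) (z : {z : ℂ // z.im ≠ 0}),
            (z : ℂ) ∈ SCI.resolventPoints A.1.1 ∧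
            (∀ n, (Function.support (Γ n A z : ℕ → ℂ)).Finite) ∧
            Tendsto (fun n => Γ n A z) atTop (𝓝 (SCI.Res z A.1.1 A.1.2))) ∧
          (∀ A : SCI.Omega f α β, ∃ C : ℝ, ∀ (z : {z : ℂ // z.im ≠ 0}) (n : ℕ),
            0 < α n + β n →
            ‖Γ n A z - SCI.Res z A.1.1 A.1.2‖ ≤ C / |(z : ℂ).im| * (α n + β n)) := by
  refine ⟨SCI.searchProgram, fun f α β hf hα hβ hα0 hβ0 => ?_⟩
  have run : ∀ (n : ℕ) (A : SCI.Omega f α β) (z : {z : ℂ // z.im ≠ 0}), ∃ k w,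
      SCI.Accepts (SCI.oracle f α β A.1.1 A.1.2 z) (SCI.tol α β n) k w ∧
      SCI.Computes SCI.searchProgram (SCI.oracle f α β A.1.1 A.1.2 z) n (SCI.codeVec k w) :=
    fun n A z => SCI.computes_searchProgram
      (SCI.exists_accepts hα0 hβ0 A.2.1 z.2 (SCI.tol_pos α β n))
  choose k w hacc hcomp using run
  have bound : ∀ A : SCI.Omega f α β, ∃ C : ℝ, ∀ (z : {z : ℂ // z.im ≠ 0}) (n : ℕ),
      ‖SCI.codeVec (k n A z) (w n A z) - SCI.Res z A.1.1 A.1.2‖ ≤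
        C / |(z : ℂ).im| * SCI.tol α β n := by
    intro A
    obtain ⟨C, hC⟩ := SCI.exists_norm_residual_le_of_accepts hf hα hβ A.2
    refine ⟨C, fun z n => (SCI.norm_sum_smul_e_sub_Res_le A.2.1 z.2 _ _ _).trans ?_⟩
    rw [div_mul_eq_mul_div]
    exact div_le_div_of_nonneg_right (hC z _ _ _ (SCI.tol_pos α β n) (hacc n A z)) (abs_nonneg _)
  refine ⟨fun n A z => SCI.codeVec (k n A z) (w n A z), hcomp, fun A z =>
    ⟨SCI.mem_resolventPoints A.2.1.2 z.2, fun n => SCI.finite_support_codeVec _ _, ?_⟩, fun A => ?_⟩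
  · obtain ⟨C, hC⟩ := bound A
    rw [tendsto_iff_norm_sub_tendsto_zero]
    refine squeeze_zero (fun n => norm_nonneg _) (hC z) ?_
    simpa using (SCI.tendsto_tol hα hβ hα0 hβ0).const_mul (C / |(z : ℂ).im|)
  · obtain ⟨C, hC⟩ := bound A
    refine ⟨C, fun z n hn => ?_⟩
    have h := hC z n
    rwa [SCI.tol_eq hn] at h
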